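/- Let $N\ge 1$ be an integer, let $0<s<N/2$, and put $2^*=2N/(N-2s)$. Let $$\dot H^s(\mathbb R^N)=\{u\in L^{2^*}(\mathbb R^N): |\xi|^s\hat u(\xi)\in L^2(\mathbb R^N)\},\qquad \|u\|_{\dot H^s}^2=\int_{\mathbb R^N}|\xi|^{2s}|\hat u(\xi)|^2\,d\xi,$$ where $\hat u$ is the (distributional) Fourier transform of $u$, normalized by $\hat u(\xi)=(2\pi)^{-N/2}\int e^{-ix\cdot\xi}u(x)\,dx$ for integrable $u$, and is required to be a locally integrable function. For $1\le r<\infty$ and $0\le\gamma\le N$ let $$\|u\|_{\mathcal L^{r,\gamma}}^r=\sup_{R>0,\;x\in\mathbb R^N} R^{\gamma}\,\frac1{|B_R(x)|}\int_{B_R(x)}|u(y)|^r\,dy$$ be the homogeneous Morrey norm. Then there exists a constant $C>0$ depending only on $N$ and $s$ such that, for every $\theta$ with $2/2^*\le\theta<1$ and every $r$ with $1\le r<2^*$, $$\|u\|_{L^{2^*}}\le C\,\|u\|_{\dot H^s}^{\theta}\,\|u\|_{\mathcal L^{r,\,r(N-2s)/2}}^{1-\theta}\qquad\text{for all } u\in\dot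 H^s(\mathbb R^N).$$ -/

import Mathlib

open MeasureTheory
open scoped ENNReal

noncomputable section

/-- The critical Sobolev exponent `2* = 2N / (N - 2s)`. -/
def critExp (N : ℕ) (s : ℝ) : ℝ := 2 * N / (N - 2 * s)

/-- The tempered distribution defined by the function `u` on `ℝ^N` has as its Fourier transform the
locally integrable function `v`, that is `⟨v, φ⟩ = ⟨u, 𝓕 φ⟩` for all Schwartz functions `φ`, where
`𝓕 φ (ξ) = ∫ exp (-2πi x·ξ) φ x dx`. All the integrals are required to converge absolutely. -/
def HasFourierTransform {N : ℕ} (u v : EuclideanSpace ℝ (Fin N) → ℂ) : Prop :=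
  LocallyIntegrable v volume ∧
    ∀ φ : SchwartzMap (EuclideanSpace ℝ (Fin N)) ℂ,
      Integrable (fun x => u x * (FourierTransform.fourier φ) x) volume ∧
      Integrable (fun ξ => v ξ * φ ξ) volume ∧
      ∫ ξ, v ξ * φ ξ = ∫ x, u x * (FourierTransform.fourier φ) x

/-- The symbol of `(-Δ)^(s/2)` applied to the Fourier transform `v`. In the normalization
`∫ exp (-2πi x·ξ) u x dx` of the transform the frequency variable is `2πξ`: with the unitary
transform `û ξ = (2π)^(-N/2) ∫ exp (-i x·ξ) u x dx` one has `û (2πξ) = (2π)^(-N/2) v ξ`,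
so that `∫ ‖ξ‖^(2s) |û ξ|² dξ = ∫ (2π‖ξ‖)^(2s) |v ξ|² dξ`, with no further constant. -/
def fracSymbol {N : ℕ} (s : ℝ) (v : EuclideanSpace ℝ (Fin N) → ℂ) :
    EuclideanSpace ℝ (Fin N) → ℂ :=
  fun ξ => (((2 * Real.pi * ‖ξ‖) ^ s : ℝ) : ℂ) * v ξ

/-- The homogeneous Sobolev space: `u ∈ L^{2*}` such that the Fourier transform of `u` is
a function `v` with `|ξ|^s v ∈ L²`. -/
def MemHomSobolev {N : ℕ} (s : ℝ) (u : EuclideanSpace ℝ (Fin N) → ℂ) : Prop :=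
  MemLp u (ENNReal.ofReal (critExp N s)) volume ∧
    ∃ v : EuclideanSpace ℝ (Fin N) → ℂ, HasFourierTransform u v ∧ MemLp (fracSymbol s v) 2 volume

/-- The norm `‖|ξ|^s û‖_{L²}` of the homogeneous Sobolev space. The Fourier transform of `u` is
unique up to null sets, so the infimum is over copies of one number; it is `∞` if the transform is
not a function. -/
def homSobolevNorm {N : ℕ} (s : ℝ) (u : EuclideanSpace ℝ (Fin N) → ℂ) : ℝ≥0∞ :=
  ⨅ (v : EuclideanSpace ℝ (Fin N) → ℂ) (_ : HasFourierTransform u v),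
    eLpNorm (fracSymbol s v) 2 volume

/-- The homogeneous Morrey norm: its `r`-th power is the supremum over all balls of
`R^γ` times the mean of `|u|^r` over the ball. -/
def morreyNorm {N : ℕ} (r γ : ℝ) (u : EuclideanSpace ℝ (Fin N) → ℂ) : ℝ≥0∞ :=
  (⨆ (x : EuclideanSpace ℝ (Fin N)) (R : ℝ) (_ : 0 < R),
    ENNReal.ofReal (R ^ γ) * ⨍⁻ y in Metric.ball x R, ‖u y‖ₑ ^ r ∂volume) ^ (1 / r)

end

/-! Write p = 2*, γ = (N - 2s)/2 = N/p, and M for the Morrey norm. Split u at frequency 1/t. The low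
part averages u against a rapidly decaying kernel of width t, so it is at most C t^(-γ) M pointwise
(`exists_enorm_lowFrequency_le`). For each level l choose t so that this bound is l/2. Then {|u| >
l} is seen only by the high part, and Chebyshev with Plancherel bounds its measure by 4 l^(-2) times
the integral of |v|² over {l < C M |ξ|^γ} (`exists_measure_lt_norm_le`). Multiplying by p l^(p-1)
and integrating in l, the layer cake formula turns this into a multiple of M^(p-2) ∫ |ξ|^(γ(p-2))
|v|², and γ(p-2) = 2s. This is the endpoint θ = 2/p.

For larger θ, M ≤ c ‖u‖_p inserted into the endpoint inequality gives M ≤ S ‖u‖_{Ḣ^s}, so part of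
the power of M can be traded for the Sobolev norm. The exponent r enters only through Jensen's
inequality on balls, with constant one, so no constant depends on it. -/

open SchwartzMap FourierTransform Real
open scoped ContDiff InnerProductSpace

/-! ### Plancherel and the frequency splitting -/

/-- The inverse Fourier transform is self-adjoint for the bilinear pairing of integrable
functions. -/
theorem integral_fourierInv_mul_eq_flip {N : ℕ} {f g : EuclideanSpace ℝ (Fin N) → ℂ}
    (hf : Integrable f) (hg : Integrable g) :
    ∫ x, g x * 𝓕⁻ f x = ∫ ξ, 𝓕⁻ g ξ * f ξ := by
  have h := VectorFourier.integral_fourierIntegral_smul_eq_flip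
    (L := -innerₗ (EuclideanSpace ℝ (Fin N))) (μ := volume) (ν := volume)
    Real.continuous_fourierChar (by simp only [LinearMap.neg_apply, innerₗ_apply_apply]; fun_prop)
    hg hf
  have hflip : (-innerₗ (EuclideanSpace ℝ (Fin N))).flip = -innerₗ (EuclideanSpace ℝ (Fin N)) := by
    ext x y
    simp [real_inner_comm]
  rw [hflip] at h
  exact h.symm

theorem continuous_fourierInv_of_integrable {N : ℕ} {f : EuclideanSpace ℝ (Fin N) → ℂ}
    (hf : Integrable f) : Continuous (𝓕⁻ f) :=
  VectorFourier.fourierIntegral_continuous Real.continuous_fourierChar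
    (by simp only [LinearMap.neg_apply, innerₗ_apply_apply]; fun_prop) hf

/-- A square integrable function is the Fourier transform of a square integrable function with the
same norm. -/
theorem exists_memLp_two_integral_mul_eq {N : ℕ} {f : EuclideanSpace ℝ (Fin N) → ℂ}
    (hf : MemLp f 2) :
    ∃ w : EuclideanSpace ℝ (Fin N) → ℂ, MemLp w 2 ∧ eLpNorm w 2 = eLpNorm f 2 ∧
      ∀ g : 𝓢(EuclideanSpace ℝ (Fin N), ℂ), ∫ x, g x * w x = ∫ ξ, (𝓕⁻ g) ξ * f ξ := by
  refine ⟨(𝓕⁻ (hf.toLp f) : Lp ℂ 2 volume), Lp.memLp _, ?_, fun g => ?_⟩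
  · have h : ‖(𝓕⁻ (hf.toLp f) : Lp ℂ 2 (volume : Measure (EuclideanSpace ℝ (Fin N))))‖
        = ‖hf.toLp f‖ := (Lp.fourierTransformₗᵢ _ _).symm.norm_map _
    rw [Lp.norm_def, Lp.norm_def,
      ENNReal.toReal_eq_toReal_iff' (Lp.memLp _).2.ne (Lp.memLp _).2.ne] at h
    rw [h, eLpNorm_congr_ae hf.coeFn_toLp]
  · have h := DFunLike.congr_fun (Lp.fourierInv_toTemperedDistribution_eq (hf.toLp f)) g
    rw [TemperedDistribution.fourierInv_apply, Lp.toTemperedDistribution_apply,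
      Lp.toTemperedDistribution_apply] at h
    simp only [smul_eq_mul] at h
    rw [← h]
    refine integral_congr_ae ?_
    filter_upwards [hf.coeFn_toLp] with x hx
    rw [hx]

/-- Splitting a function by a frequency cutoff `ψ`: the high frequency part is controlled
in `L²`. -/
theorem exists_highFrequency {N : ℕ} {u v : EuclideanSpace ℝ (Fin N) → ℂ}
    (hu : LocallyIntegrable u) (huv : HasFourierTransform u v)
    (ψ : 𝓢(EuclideanSpace ℝ (Fin N), ℂ)) (hψ : MemLp (fun ξ => v ξ * (1 - ψ ξ)) 2) :
    ∃ w : EuclideanSpace ℝ (Fin N) → ℂ, MemLp w 2 ∧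
      eLpNorm w 2 = eLpNorm (fun ξ => v ξ * (1 - ψ ξ)) 2 ∧
      ∀ᵐ x, u x = 𝓕⁻ (fun ξ => v ξ * ψ ξ) x + w x := by
  obtain ⟨w, hw, hnorm, hpair⟩ := exists_memLp_two_integral_mul_eq hψ
  refine ⟨w, hw, hnorm, ?_⟩
  have hint : Integrable (fun ξ => v ξ * ψ ξ) := (huv.2 ψ).2.1
  have hcont := continuous_fourierInv_of_integrable hint
  have hwloc : LocallyIntegrable w := hw.locallyIntegrable (by norm_num)
  have hloc : LocallyIntegrable (fun x => u x - 𝓕⁻ (fun ξ => v ξ * ψ ξ) x - w x) :=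
    (hu.sub hcont.locallyIntegrable).sub hwloc
  -- The identity is tested against smooth compactly supported g; moving the inverse transform onto
  -- g leaves v = vψ + v(1 - ψ).
  have key := ae_eq_zero_of_integral_contDiff_smul_eq_zero hloc ?_
  · filter_upwards [key] with x hx
    linear_combination hx
  intro g hg hgc
  have hgc' : HasCompactSupport (fun x => (g x : ℂ)) := hgc.comp_left Complex.ofReal_zero
  have hg' : ContDiff ℝ ∞ (fun x => (g x : ℂ)) := Complex.ofRealCLM.contDiff.comp hg
  set G : 𝓢(EuclideanSpace ℝ (Fin N), ℂ) := hgc'.toSchwartzMap hg' with hG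
  have hGx : ∀ x, G x = g x := fun x => rfl
  have hiu : Integrable (fun x => G x * u x) :=
    hu.integrable_smul_left_of_hasCompactSupport G.continuous hgc'
  have hil : Integrable (fun x => G x * 𝓕⁻ (fun ξ => v ξ * ψ ξ) x) :=
    hcont.locallyIntegrable.integrable_smul_left_of_hasCompactSupport G.continuous hgc'
  have hiw : Integrable (fun x => G x * w x) :=
    hwloc.integrable_smul_left_of_hasCompactSupport G.continuous hgc'
  have h1 : ∫ x, G x * u x = ∫ ξ, (𝓕⁻ G) ξ * v ξ := by
    have h := (huv.2 (𝓕⁻ G)).2.2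
    rw [FourierTransform.fourier_fourierInv_eq] at h
    simpa only [mul_comm] using h.symm
  have h2 : ∫ x, G x * 𝓕⁻ (fun ξ => v ξ * ψ ξ) x = ∫ ξ, (𝓕⁻ G) ξ * (v ξ * ψ ξ) := by
    rw [integral_fourierInv_mul_eq_flip hint G.integrable, SchwartzMap.fourierInv_coe]
  have hi1 : Integrable (fun ξ => (𝓕⁻ G) ξ * v ξ) := by
    simpa only [mul_comm] using (huv.2 (𝓕⁻ G)).2.1
  have hi2 : Integrable (fun ξ => (𝓕⁻ G) ξ * (v ξ * ψ ξ)) := by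
    have := (hint.bdd_mul (c := SchwartzMap.seminorm ℂ 0 0 (𝓕⁻ G))
      (𝓕⁻ G).continuous.aestronglyMeasurable
      (Filter.Eventually.of_forall fun ξ => SchwartzMap.norm_le_seminorm ℂ (𝓕⁻ G) ξ))
    exact this
  calc ∫ x, g x • (u x - 𝓕⁻ (fun ξ => v ξ * ψ ξ) x - w x)
      = ∫ x, (G x * u x - G x * 𝓕⁻ (fun ξ => v ξ * ψ ξ) x) - G x * w x := by
        refine integral_congr_ae (Filter.Eventually.of_forall fun x => ?_)
        simp only [hGx, Complex.real_smul]
        ring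
    _ = 0 := by
        rw [integral_sub (f := fun x => G x * u x - G x * 𝓕⁻ (fun ξ => v ξ * ψ ξ) x)
          (hiu.sub hil) hiw, integral_sub hiu hil, h1, h2, hpair G,
          ← integral_sub hi1 hi2, sub_eq_zero]
        refine integral_congr_ae (Filter.Eventually.of_forall fun ξ => ?_)
        ring

/-! ### The low frequency part as an average -/

/-- The low frequency part of `u` as a mean of `u`. -/
theorem fourierInv_mul_eq_integral {N : ℕ} {u v : EuclideanSpace ℝ (Fin N) → ℂ}
    (huv : HasFourierTransform u v) (ψ : 𝓢(EuclideanSpace ℝ (Fin N), ℂ))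
    (hψ : HasCompactSupport ψ) (x : EuclideanSpace ℝ (Fin N)) :
    𝓕⁻ (fun ξ => v ξ * ψ ξ) x = ∫ y, u y * 𝓕 ψ (y - x) := by
  -- The definition of the transform is applied to the modulated cutoff, whose transform is the
  -- translate of 𝓕 ψ by x.
  have hc : HasCompactSupport (fun ξ => (𝐞 ⟪ξ, x⟫_ℝ : ℂ) * ψ ξ) := hψ.mul_left
  have hs : ContDiff ℝ ∞ (fun ξ => (𝐞 ⟪ξ, x⟫_ℝ : ℂ) * ψ ξ) := by
    refine ContDiff.mul ?_ (ψ.smooth _)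
    simp only [Real.fourierChar_apply]
    refine ((Complex.ofRealCLM.contDiff.comp ?_).mul contDiff_const).cexp
    exact contDiff_const.mul (contDiff_id.inner ℝ contDiff_const)
  have h := (huv.2 (hc.toSchwartzMap hs)).2.2
  have hval : ∀ ξ, (hc.toSchwartzMap hs) ξ = (𝐞 ⟪ξ, x⟫_ℝ : ℂ) * ψ ξ := fun _ => rfl
  have hfour : ∀ y, (𝓕 (hc.toSchwartzMap hs)) y = 𝓕 ψ (y - x) := by
    intro y
    rw [SchwartzMap.fourier_coe, SchwartzMap.fourier_coe, Real.fourier_eq, Real.fourier_eq]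
    congr 1
    ext η
    rw [hval, Circle.smul_def, Circle.smul_def, smul_eq_mul, smul_eq_mul, ← mul_assoc,
      ← Circle.coe_mul, ← AddChar.map_add_eq_mul, inner_sub_right]
    congr 3
    ring
  simp only [hval, hfour] at h
  rw [Real.fourierInv_eq, ← h]
  congr 1
  ext ξ
  rw [Circle.smul_def, smul_eq_mul]
  ring

theorem fourier_comp_smul {N : ℕ} (f : EuclideanSpace ℝ (Fin N) → ℂ) {t : ℝ} (ht : 0 < t)
    (z : EuclideanSpace ℝ (Fin N)) :
    𝓕 (fun ξ => f (t • ξ)) z = ((t ^ N)⁻¹ : ℝ) • 𝓕 f (t⁻¹ • z) := by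
  rw [Real.fourier_eq, Real.fourier_eq]
  have h := Measure.integral_comp_smul_of_nonneg (volume : Measure (EuclideanSpace ℝ (Fin N)))
    (fun ξ => 𝐞 (-⟪ξ, t⁻¹ • z⟫_ℝ) • f ξ) t (hR := ht.le)
  rw [finrank_euclideanSpace_fin] at h
  rw [← h]
  congr 1
  ext ξ
  rw [inner_smul_left, inner_smul_right]
  simp [ht.ne']

/-! ### Morrey norms and Lebesgue norms -/

theorem volume_ball_eq_ofReal_rpow_mul {N : ℕ} (x : EuclideanSpace ℝ (Fin N)) {R : ℝ}
    (hR : 0 < R) :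
    volume (Metric.ball x R) = ENNReal.ofReal (R ^ (N : ℝ)) *
      volume (Metric.ball (0 : EuclideanSpace ℝ (Fin N)) 1) := by
  rw [Measure.addHaar_ball_of_pos volume x hR, finrank_euclideanSpace_fin, Real.rpow_natCast]

/-- The `L¹` mean over a ball is at most the `L^r` mean, in terms of the Morrey norm. -/
theorem lintegral_ball_le_morreyNorm {N : ℕ} {u : EuclideanSpace ℝ (Fin N) → ℂ}
    (hu : AEStronglyMeasurable u) {r γ : ℝ} (hr : 1 ≤ r) (x : EuclideanSpace ℝ (Fin N)) {R : ℝ}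
    (hR : 0 < R) :
    ∫⁻ y in Metric.ball x R, ‖u y‖ₑ ≤
      ENNReal.ofReal (R ^ (N - γ)) * volume (Metric.ball (0 : EuclideanSpace ℝ (Fin N)) 1) *
        morreyNorm r (r * γ) u := by
  have hr0 : 0 < r := by linarith
  set μ := volume.restrict (Metric.ball x R) with hμ
  have hμ0 : μ Set.univ ≠ 0 := by
    rw [hμ, Measure.restrict_apply_univ]
    exact (Metric.measure_ball_pos volume x hR).ne'
  have hμt : μ Set.univ < ⊤ := by
    rw [hμ, Measure.restrict_apply_univ]
    exact measure_ball_lt_top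
  have hμfin : IsFiniteMeasure μ := ⟨hμt⟩
  have hμ0' : NeZero μ := ⟨fun h => hμ0 (by simp [h])⟩
  -- On the normalized ball, L^p norms increase with the exponent, with constant one.
  have hprob : IsProbabilityMeasure ((μ Set.univ)⁻¹ • μ) := inferInstance
  have hmean : ⨍⁻ y, ‖u y‖ₑ ∂μ ≤ (⨍⁻ y, ‖u y‖ₑ ^ r ∂μ) ^ (1 / r) := by
    have h := eLpNorm_le_eLpNorm_of_exponent_le (p := 1) (q := ENNReal.ofReal r)
      (by simpa using hr) ((hu.restrict (s := Metric.ball x R)).smul_measure (μ Set.univ)⁻¹)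
    rw [eLpNorm_one_eq_lintegral_enorm, eLpNorm_eq_lintegral_rpow_enorm_toReal
      (by simpa using hr0) ENNReal.ofReal_ne_top, ENNReal.toReal_ofReal hr0.le] at h
    exact h
  have hsup : ENNReal.ofReal (R ^ γ) * (⨍⁻ y, ‖u y‖ₑ ^ r ∂μ) ^ (1 / r) ≤
      morreyNorm r (r * γ) u := by
    have h1 : ENNReal.ofReal (R ^ γ) = ENNReal.ofReal (R ^ (r * γ)) ^ (1 / r) := by
      rw [ENNReal.ofReal_rpow_of_pos (by positivity), ← Real.rpow_mul hR.le]
      congr 2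
      field_simp
    rw [h1, ← ENNReal.mul_rpow_of_nonneg _ _ (by positivity), morreyNorm]
    refine ENNReal.rpow_le_rpow ?_ (by positivity)
    exact le_iSup_of_le x (le_iSup_of_le R (le_iSup_of_le hR le_rfl))
  have hγ : ENNReal.ofReal (R ^ (N - γ)) * ENNReal.ofReal (R ^ γ) =
      ENNReal.ofReal (R ^ (N : ℝ)) := by
    rw [← ENNReal.ofReal_mul (by positivity), ← Real.rpow_add hR]
    congr 2
    ring
  calc ∫⁻ y, ‖u y‖ₑ ∂μ = μ Set.univ * ⨍⁻ y, ‖u y‖ₑ ∂μ := (measure_mul_laverage _ _).symm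
    _ = ENNReal.ofReal (R ^ (N - γ)) * volume (Metric.ball (0 : EuclideanSpace ℝ (Fin N)) 1) *
        (ENNReal.ofReal (R ^ γ) * ⨍⁻ y, ‖u y‖ₑ ∂μ) := by
        rw [hμ, Measure.restrict_apply_univ, volume_ball_eq_ofReal_rpow_mul x hR, ← hγ]
        ring
    _ ≤ _ := by
        gcongr
        exact (mul_le_mul_right hmean _).trans hsup

/-- The Morrey norm is controlled by the Lebesgue norm of the same homogeneity. -/
theorem morreyNorm_le_eLpNorm {N : ℕ} {u : EuclideanSpace ℝ (Fin N) → ℂ}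
    (hu : AEStronglyMeasurable u) {r γ p : ℝ} (hr : 1 ≤ r) (hrp : r ≤ p) (hp : γ * p = N) :
    morreyNorm r (r * γ) u ≤
      (volume (Metric.ball (0 : EuclideanSpace ℝ (Fin N)) 1))⁻¹ ^ (1 / p) *
        eLpNorm u (ENNReal.ofReal p) := by
  have hr0 : 0 < r := by linarith
  have hp0 : 0 < p := by linarith
  rw [morreyNorm, one_div, ENNReal.rpow_inv_le_iff hr0]
  refine iSup_le fun x => iSup_le fun R => iSup_le fun hR => ?_
  set μ := volume.restrict (Metric.ball x R) with hμ
  have hμu : μ Set.univ = volume (Metric.ball x R) := Measure.restrict_apply_univ _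
  have hμ0 : μ Set.univ ≠ 0 := by
    rw [hμu]
    exact (Metric.measure_ball_pos volume x hR).ne'
  have hμt : μ Set.univ < ⊤ := by
    rw [hμu]
    exact measure_ball_lt_top
  have hμfin : IsFiniteMeasure μ := ⟨hμt⟩
  have hμ0' : NeZero μ := ⟨fun h => hμ0 (by simp [h])⟩
  have hprob : IsProbabilityMeasure ((μ Set.univ)⁻¹ • μ) := inferInstance
  have hmean : (⨍⁻ y, ‖u y‖ₑ ^ r ∂μ) ^ (1 / r) ≤
      (μ Set.univ)⁻¹ ^ (1 / p) * eLpNorm u (ENNReal.ofReal p) := by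
    have h := eLpNorm_le_eLpNorm_of_exponent_le (p := ENNReal.ofReal r) (q := ENNReal.ofReal p)
      (ENNReal.ofReal_le_ofReal hrp)
      ((hu.restrict (s := Metric.ball x R)).smul_measure (μ Set.univ)⁻¹)
    rw [eLpNorm_eq_lintegral_rpow_enorm_toReal
      (by simpa using hr0) ENNReal.ofReal_ne_top, ENNReal.toReal_ofReal hr0.le,
      eLpNorm_smul_measure_of_ne_top ENNReal.ofReal_ne_top, one_div (ENNReal.ofReal p),
      ENNReal.toReal_inv, ENNReal.toReal_ofReal hp0.le, ← one_div p, smul_eq_mul] at h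
    refine h.trans ?_
    gcongr
    exact Measure.restrict_le_self
  -- Since γ p = N, the factor R^γ |B_R|^(-1/p) does not depend on R.
  have hscale : ENNReal.ofReal (R ^ γ) * (μ Set.univ)⁻¹ ^ (1 / p) =
      (volume (Metric.ball (0 : EuclideanSpace ℝ (Fin N)) 1))⁻¹ ^ (1 / p) := by
    have hRp : ENNReal.ofReal (R ^ (N : ℝ)) = ENNReal.ofReal (R ^ γ) ^ p := by
      rw [ENNReal.ofReal_rpow_of_pos (by positivity), ← Real.rpow_mul hR.le, hp]
    have hR0 : ENNReal.ofReal (R ^ γ) ≠ 0 := by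
      simpa using Real.rpow_pos_of_pos hR γ
    rw [hμu, volume_ball_eq_ofReal_rpow_mul x hR, hRp,
      ENNReal.mul_inv (Or.inr measure_ball_lt_top.ne)
        (Or.inr (Metric.measure_ball_pos volume _ one_pos).ne'),
      ENNReal.mul_rpow_of_nonneg _ _ (by positivity), ← mul_assoc, ← ENNReal.inv_rpow,
      ← ENNReal.rpow_mul, mul_one_div_cancel hp0.ne', ENNReal.rpow_one,
      ENNReal.mul_inv_cancel hR0 ENNReal.ofReal_ne_top, one_mul]
  have hpow : ENNReal.ofReal (R ^ (r * γ)) = ENNReal.ofReal (R ^ γ) ^ r := by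
    rw [ENNReal.ofReal_rpow_of_pos (by positivity), ← Real.rpow_mul hR.le, mul_comm]
  rw [hpow, ← hscale, mul_assoc, ENNReal.mul_rpow_of_nonneg _ _ hr0.le]
  gcongr
  rw [one_div, ENNReal.rpow_inv_le_iff hr0] at hmean
  exact hmean

/-! ### Pointwise bound for the low frequencies -/

/-- Dyadic majorization of a decaying function. -/
theorem ofReal_le_tsum_indicator_ball {N : ℕ} {K : ℝ} (hK : 0 ≤ K)
    (z : EuclideanSpace ℝ (Fin N)) {b : ℝ} (hb : (1 + ‖z‖) ^ N * b ≤ K) :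
    ENNReal.ofReal b ≤ ∑' k : ℕ, (Metric.ball (0 : EuclideanSpace ℝ (Fin N)) (2 ^ k)).indicator
      (fun _ => ENNReal.ofReal (K * 2 ^ N * ((2 : ℝ) ^ k) ^ (-(N : ℝ)))) z := by
  have hex : ∃ k : ℕ, ‖z‖ < 2 ^ k := pow_unbounded_of_one_lt _ one_lt_two
  classical
  set k := Nat.find hex with hk
  have hkz : ‖z‖ < 2 ^ k := Nat.find_spec hex
  refine le_trans ?_ (ENNReal.le_tsum k)
  rw [Set.indicator_of_mem (by simpa using hkz)]
  refine ENNReal.ofReal_le_ofReal ?_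
  -- Minimality of k gives 2^k ≤ 2‖z‖ for k > 0; the 1 covers k = 0.
  have h2 : (2 : ℝ) ^ k ≤ 2 * (1 + ‖z‖) := by
    rcases Nat.eq_zero_or_pos k with h0 | hpos
    · rw [h0]
      have := norm_nonneg z
      linarith
    · have hmin := Nat.find_min hex (m := k - 1) (by omega)
      obtain ⟨j, hj⟩ : ∃ j, k = j + 1 := ⟨k - 1, by omega⟩
      rw [hj] at hmin ⊢
      simp only [Nat.add_sub_cancel, not_lt] at hmin
      rw [pow_succ]
      linarith
  rw [Real.rpow_neg (by positivity), Real.rpow_natCast, ← div_eq_mul_inv,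
    le_div_iff₀ (by positivity)]
  have hz : 0 < (1 + ‖z‖) ^ N := by positivity
  rcases le_total b 0 with hb0 | hb0
  · exact (mul_nonpos_of_nonpos_of_nonneg hb0 (by positivity)).trans (by positivity)
  calc b * ((2 : ℝ) ^ k) ^ N ≤ b * (2 * (1 + ‖z‖)) ^ N := by gcongr
    _ = (1 + ‖z‖) ^ N * b * 2 ^ N := by rw [mul_pow]; ring
    _ ≤ K * 2 ^ N := by gcongr

/-- Integration against a dilated kernel with decay of order `N` is controlled by
the Morrey norm. -/
theorem lintegral_mul_kernel_le_morreyNorm {N : ℕ} {γ : ℝ} (hγ : 0 < γ) {K : ℝ} (hK : 0 ≤ K)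
    {φ : EuclideanSpace ℝ (Fin N) → ℂ} (hφ : ∀ z, (1 + ‖z‖) ^ N * ‖φ z‖ ≤ K)
    {u : EuclideanSpace ℝ (Fin N) → ℂ} (hu : AEStronglyMeasurable u) {r : ℝ} (hr : 1 ≤ r)
    (x : EuclideanSpace ℝ (Fin N)) {t : ℝ} (ht : 0 < t) :
    ∫⁻ y, ‖u y‖ₑ * ‖φ (t⁻¹ • (y - x))‖ₑ ≤
      ENNReal.ofReal (K * 2 ^ N * (1 - 2 ^ (-γ))⁻¹ * t ^ (N - γ)) *
        volume (Metric.ball (0 : EuclideanSpace ℝ (Fin N)) 1) * morreyNorm r (r * γ) u := by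
  set V := volume (Metric.ball (0 : EuclideanSpace ℝ (Fin N)) 1)
  set M := morreyNorm r (r * γ) u
  set c : ℕ → ℝ := fun k => K * 2 ^ N * ((2 : ℝ) ^ k) ^ (-(N : ℝ)) with hc
  have hq0 : (0 : ℝ) ≤ 2 ^ (-γ) := by positivity
  have hq1 : (2 : ℝ) ^ (-γ) < 1 := Real.rpow_lt_one_of_one_lt_of_neg one_lt_two (by linarith)
  have hball : ∀ (k : ℕ) y, (Metric.ball (0 : EuclideanSpace ℝ (Fin N)) (2 ^ k)).indicator
      (fun _ => ENNReal.ofReal (c k)) (t⁻¹ • (y - x)) =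
      (Metric.ball x (t * 2 ^ k)).indicator (fun _ => ENNReal.ofReal (c k)) y := by
    intro k y
    have : t⁻¹ • (y - x) ∈ Metric.ball (0 : EuclideanSpace ℝ (Fin N)) (2 ^ k) ↔
        y ∈ Metric.ball x (t * 2 ^ k) := by
      rw [mem_ball_zero_iff, mem_ball_iff_norm, norm_smul, norm_inv, Real.norm_of_nonneg ht.le,
        inv_mul_lt_iff₀ ht]
    by_cases hy : y ∈ Metric.ball x (t * 2 ^ k)
    · rw [Set.indicator_of_mem hy, Set.indicator_of_mem (this.2 hy)]
    · rw [Set.indicator_of_notMem hy, Set.indicator_of_notMem (mt this.1 hy)]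
  calc ∫⁻ y, ‖u y‖ₑ * ‖φ (t⁻¹ • (y - x))‖ₑ
      ≤ ∫⁻ y, ∑' k : ℕ, (Metric.ball x (t * 2 ^ k)).indicator
          (fun y => ENNReal.ofReal (c k) * ‖u y‖ₑ) y := by
        refine lintegral_mono fun y => ?_
        rw [← ofReal_norm (φ _)]
        refine (mul_le_mul_right (ofReal_le_tsum_indicator_ball hK _ (hφ _)) _).trans ?_
        rw [← ENNReal.tsum_mul_left]
        refine ENNReal.tsum_le_tsum fun k => ?_
        rw [hball k y]
        by_cases hy : y ∈ Metric.ball x (t * 2 ^ k)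
        · rw [Set.indicator_of_mem hy, Set.indicator_of_mem hy, mul_comm]
        · simp [Set.indicator_of_notMem hy]
    _ = ∑' k : ℕ, ENNReal.ofReal (c k) * ∫⁻ y in Metric.ball x (t * 2 ^ k), ‖u y‖ₑ := by
        rw [lintegral_tsum fun k => (hu.enorm.const_mul _).indicator measurableSet_ball]
        refine tsum_congr fun k => ?_
        rw [lintegral_indicator measurableSet_ball, lintegral_const_mul' _ _ ENNReal.ofReal_ne_top]
    _ ≤ ∑' k : ℕ, ENNReal.ofReal (c k) *
          (ENNReal.ofReal ((t * 2 ^ k) ^ (N - γ)) * V * M) := by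
        refine ENNReal.tsum_le_tsum fun k => ?_
        gcongr
        exact lintegral_ball_le_morreyNorm hu hr x (by positivity)
    -- Kernel decay 2^(-kN) against mass growth 2^(k(N-γ)) leaves a geometric series of ratio
    -- 2^(-γ), convergent because γ > 0.
    _ = ∑' k : ℕ, ENNReal.ofReal (K * 2 ^ N * t ^ (N - γ) * ((2 : ℝ) ^ (-γ)) ^ k) * (V * M) := by
        refine tsum_congr fun k => ?_
        rw [mul_assoc (ENNReal.ofReal _) V M, ← mul_assoc, ← ENNReal.ofReal_mul (by positivity)]
        congr 2
        have h2 : ((2 : ℝ) ^ k) ^ (-(N : ℝ)) * ((2 : ℝ) ^ k) ^ (N - γ) = ((2 : ℝ) ^ (-γ)) ^ k := by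
          rw [← Real.rpow_add (by positivity), ← Real.rpow_natCast, ← Real.rpow_natCast,
            ← Real.rpow_mul (by norm_num), ← Real.rpow_mul (by norm_num)]
          congr 1
          ring
        rw [Real.mul_rpow ht.le (by positivity), ← h2]
        ring
    _ = _ := by
        rw [ENNReal.tsum_mul_right, ← ENNReal.ofReal_tsum_of_nonneg (fun k => by positivity)
          ((summable_geometric_of_lt_one hq0 hq1).mul_left _), tsum_mul_left,
          tsum_geometric_of_lt_one hq0 hq1, mul_assoc (ENNReal.ofReal _) V M]
        congr 2
        ring

theorem SchwartzMap.exists_one_add_norm_pow_mul_norm_le {N : ℕ}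
    (f : 𝓢(EuclideanSpace ℝ (Fin N), ℂ)) (k : ℕ) :
    ∃ K : ℝ, 0 < K ∧ ∀ z, (1 + ‖z‖) ^ k * ‖f z‖ ≤ K := by
  have h := SchwartzMap.one_add_le_sup_seminorm_apply (𝕜 := ℂ) (m := (k, 0)) le_rfl le_rfl f
  simp only [norm_iteratedFDeriv_zero] at h
  exact ⟨max 1 _, by positivity, fun z => (h z).trans (le_max_right _ _)⟩

/-- Dilating the cutoff by t turns its transform into t^(-N) 𝓕 χ(·/t), a kernel of width t. -/
theorem enorm_fourierInv_mul_le {N : ℕ} {u v : EuclideanSpace ℝ (Fin N) → ℂ}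
    (huv : HasFourierTransform u v) {χ ψ : 𝓢(EuclideanSpace ℝ (Fin N), ℂ)}
    (hχ : HasCompactSupport χ) {t : ℝ} (ht : 0 < t) (hψ : ∀ ξ, ψ ξ = χ (t • ξ))
    (x : EuclideanSpace ℝ (Fin N)) :
    ‖𝓕⁻ (fun ξ => v ξ * ψ ξ) x‖ₑ ≤
      ENNReal.ofReal (t ^ N)⁻¹ * ∫⁻ y, ‖u y‖ₑ * ‖(𝓕 χ) (t⁻¹ • (y - x))‖ₑ := by
  have hψc : HasCompactSupport ψ := by
    have : (ψ : EuclideanSpace ℝ (Fin N) → ℂ) = χ ∘ (Homeomorph.smulOfNeZero t ht.ne') := by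
      ext ξ
      exact hψ ξ
    rw [this]
    exact hχ.comp_homeomorph _
  have hF : ∀ z, (𝓕 ψ) z = ((t ^ N)⁻¹ : ℝ) • (𝓕 χ) (t⁻¹ • z) := by
    intro z
    rw [SchwartzMap.fourier_coe, SchwartzMap.fourier_coe, ← fourier_comp_smul _ ht,
      show (ψ : EuclideanSpace ℝ (Fin N) → ℂ) = fun ξ => χ (t • ξ) from funext hψ]
  rw [fourierInv_mul_eq_integral huv ψ hψc x]
  refine (enorm_integral_le_lintegral_enorm _).trans_eq ?_
  rw [← lintegral_const_mul' _ _ ENNReal.ofReal_ne_top]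
  refine lintegral_congr fun y => ?_
  rw [hF, enorm_mul, enorm_smul, Real.enorm_of_nonneg (by positivity)]
  ring

/-- The part of `u` of frequency below `1 / t` is bounded pointwise by the Morrey norm. -/
theorem exists_enorm_lowFrequency_le {N : ℕ} {γ : ℝ} (hγ : 0 < γ)
    (χ : 𝓢(EuclideanSpace ℝ (Fin N), ℂ)) (hχ : HasCompactSupport χ) :
    ∃ C : ℝ, 0 < C ∧ ∀ u v : EuclideanSpace ℝ (Fin N) → ℂ, AEStronglyMeasurable u →
      HasFourierTransform u v → ∀ r : ℝ, 1 ≤ r → ∀ t : ℝ, 0 < t →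
      ∀ ψ : 𝓢(EuclideanSpace ℝ (Fin N), ℂ), (∀ ξ, ψ ξ = χ (t • ξ)) → ∀ x,
        ‖𝓕⁻ (fun ξ => v ξ * ψ ξ) x‖ₑ ≤
          ENNReal.ofReal (C * t ^ (-γ)) * morreyNorm r (r * γ) u := by
  obtain ⟨K, hK0, hK⟩ := (𝓕 χ).exists_one_add_norm_pow_mul_norm_le N
  set V := volume (Metric.ball (0 : EuclideanSpace ℝ (Fin N)) 1) with hV
  have hVt : V ≠ ⊤ := measure_ball_lt_top.ne
  have hV0 : 0 < V.toReal :=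
    ENNReal.toReal_pos (Metric.measure_ball_pos volume _ one_pos).ne' hVt
  have hq1 : (2 : ℝ) ^ (-γ) < 1 := Real.rpow_lt_one_of_one_lt_of_neg one_lt_two (by linarith)
  have hq : 0 < (1 - (2 : ℝ) ^ (-γ))⁻¹ := inv_pos.2 (by linarith)
  refine ⟨K * 2 ^ N * (1 - 2 ^ (-γ))⁻¹ * V.toReal, by positivity, ?_⟩
  intro u v hu huv r hr t ht ψ hψ x
  refine (enorm_fourierInv_mul_le huv hχ ht hψ x).trans ?_
  calc ENNReal.ofReal (t ^ N)⁻¹ * ∫⁻ y, ‖u y‖ₑ * ‖(𝓕 χ) (t⁻¹ • (y - x))‖ₑ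
      ≤ ENNReal.ofReal (t ^ N)⁻¹ * (ENNReal.ofReal (K * 2 ^ N * (1 - 2 ^ (-γ))⁻¹ * t ^ (N - γ)) *
          V * morreyNorm r (r * γ) u) := by
        gcongr
        exact lintegral_mul_kernel_le_morreyNorm hγ hK0.le hK hu hr x ht
    _ = _ := by
        conv_lhs => rw [← ENNReal.ofReal_toReal hVt]
        rw [← mul_assoc, ← mul_assoc, ← ENNReal.ofReal_mul (by positivity),
          ← ENNReal.ofReal_mul (by positivity)]
        congr 2
        have : t ^ (N - γ) = t ^ N * t ^ (-γ) := by
          rw [sub_eq_add_neg, Real.rpow_add ht, Real.rpow_natCast]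
        rw [this]
        field_simp

/-! ### High frequencies and the distribution function -/

theorem exists_schwartzMap_cutoff (N : ℕ) :
    ∃ χ : 𝓢(EuclideanSpace ℝ (Fin N), ℂ), HasCompactSupport χ ∧
      (∀ ξ, ‖ξ‖ ≤ 1 → χ ξ = 1) ∧ ∀ ξ, ‖1 - χ ξ‖ ≤ 1 := by
  let b : ContDiffBump (0 : EuclideanSpace ℝ (Fin N)) := ⟨1, 2, one_pos, one_lt_two⟩
  have hc : HasCompactSupport (fun ξ => (b ξ : ℂ)) :=
    b.hasCompactSupport.comp_left Complex.ofReal_zero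
  have hs : ContDiff ℝ ∞ (fun ξ => (b ξ : ℂ)) := Complex.ofRealCLM.contDiff.comp b.contDiff
  have hval : ∀ ξ, (hc.toSchwartzMap hs) ξ = (b ξ : ℂ) := fun _ => rfl
  refine ⟨hc.toSchwartzMap hs, hc, fun ξ hξ => ?_, fun ξ => ?_⟩
  · rw [hval, b.one_of_mem_closedBall (by simpa using hξ), Complex.ofReal_one]
  · rw [hval, ← Complex.ofReal_one, ← Complex.ofReal_sub, Complex.norm_real,
      Real.norm_of_nonneg (by linarith [b.le_one (x := ξ)])]
    linarith [b.nonneg (x := ξ)]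

theorem exists_schwartzMap_dilation {N : ℕ} (χ : 𝓢(EuclideanSpace ℝ (Fin N), ℂ)) {t : ℝ}
    (ht : t ≠ 0) : ∃ ψ : 𝓢(EuclideanSpace ℝ (Fin N), ℂ), ∀ ξ, ψ ξ = χ (t • ξ) :=
  ⟨SchwartzMap.compCLMOfContinuousLinearEquiv ℂ
    (ContinuousLinearEquiv.smulLeft (Units.mk0 t ht)) χ, fun _ => rfl⟩

/-- Square integrability away from the origin of the Fourier transform of a function in
the homogeneous Sobolev space. -/
theorem memLp_two_mul_one_sub_cutoff {N : ℕ} {s : ℝ} (hs : 0 ≤ s)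
    {v : EuclideanSpace ℝ (Fin N) → ℂ} (hv : AEStronglyMeasurable v)
    (hvs : MemLp (fracSymbol s v) 2) {t : ℝ} (ht : 0 < t)
    {ψ : 𝓢(EuclideanSpace ℝ (Fin N), ℂ)} (hψ1 : ∀ ξ, t * ‖ξ‖ ≤ 1 → ψ ξ = 1)
    (hψ : ∀ ξ, ‖1 - ψ ξ‖ ≤ 1) :
    MemLp (fun ξ => v ξ * (1 - ψ ξ)) 2 := by
  refine MemLp.of_le_mul (c := t ^ s) hvs
    (hv.mul (aestronglyMeasurable_const.sub ψ.continuous.aestronglyMeasurable))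
    (Filter.Eventually.of_forall fun ξ => ?_)
  rw [norm_mul, fracSymbol, norm_mul, Complex.norm_real, Real.norm_of_nonneg (by positivity)]
  -- Either 1 - ψ vanishes, or the Sobolev weight times t^s is at least 1.
  rcases le_or_gt (t * ‖ξ‖) 1 with h | h
  · rw [hψ1 ξ h]
    simp only [sub_self, norm_zero, mul_zero]
    positivity
  · rw [← mul_assoc, ← Real.mul_rpow ht.le (by positivity)]
    have h1 : 1 ≤ (t * (2 * π * ‖ξ‖)) ^ s := by
      refine Real.one_le_rpow ?_ hs
      nlinarith [Real.pi_gt_three]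
    nlinarith [hψ ξ, norm_nonneg (v ξ), norm_nonneg (1 - ψ ξ)]

/-- The distribution function of `u` is controlled by the high frequencies of `u`. -/
theorem exists_measure_lt_norm_le {N : ℕ} {s γ : ℝ} (hs : 0 ≤ s) (hγ : 0 < γ) :
    ∃ C : ℝ, 0 < C ∧ ∀ u v : EuclideanSpace ℝ (Fin N) → ℂ, LocallyIntegrable u →
      HasFourierTransform u v → MemLp (fracSymbol s v) 2 →
      ∀ r : ℝ, 1 ≤ r → ∀ m : ℝ, 0 < m → morreyNorm r (r * γ) u ≤ ENNReal.ofReal m →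
      ∀ l : ℝ, 0 < l →
        volume {x | l < ‖u x‖} ≤ ENNReal.ofReal (4 * l ^ (-2 : ℝ)) *
          ∫⁻ ξ, {ξ | l < C * m * ‖ξ‖ ^ γ}.indicator (fun ξ => ‖v ξ‖ₑ ^ (2 : ℝ)) ξ := by
  obtain ⟨χ, hχc, hχ1, hχ⟩ := exists_schwartzMap_cutoff N
  obtain ⟨C, hC, hlow⟩ := exists_enorm_lowFrequency_le hγ χ hχc
  refine ⟨2 * C, by positivity, ?_⟩
  intro u v hu huv hv r hr m hm hM l hl
  -- This t makes the low frequency bound C t^(-γ) m equal to l/2.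
  set t : ℝ := (2 * C * m / l) ^ γ⁻¹ with ht_def
  have ht : 0 < t := by positivity
  have htγ : t ^ γ = 2 * C * m / l := by
    rw [ht_def, ← Real.rpow_mul (by positivity), inv_mul_cancel₀ hγ.ne', Real.rpow_one]
  obtain ⟨ψ, hψ⟩ := exists_schwartzMap_dilation χ ht.ne'
  have hψ1 : ∀ ξ, t * ‖ξ‖ ≤ 1 → ψ ξ = 1 := fun ξ h => by
    rw [hψ, hχ1]
    rwa [norm_smul, Real.norm_of_nonneg ht.le]
  have hψle : ∀ ξ, ‖1 - ψ ξ‖ ≤ 1 := fun ξ => by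
    rw [hψ]
    exact hχ _
  have hmem := memLp_two_mul_one_sub_cutoff hs huv.1.aestronglyMeasurable hv ht hψ1 hψle
  obtain ⟨w, hw, hwnorm, hdec⟩ := exists_highFrequency hu huv ψ hmem
  have hlow' : ∀ x, ‖𝓕⁻ (fun ξ => v ξ * ψ ξ) x‖ ≤ l / 2 := by
    intro x
    have h := hlow u v hu.aestronglyMeasurable huv r hr t ht ψ hψ x
    have h' : ENNReal.ofReal (C * t ^ (-γ)) * morreyNorm r (r * γ) u ≤ ENNReal.ofReal (l / 2) := by
      refine (mul_le_mul_right hM _).trans_eq ?_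
      rw [← ENNReal.ofReal_mul (by positivity), Real.rpow_neg ht.le, htγ]
      congr 1
      field_simp
    rw [← ofReal_norm] at h
    exact (ENNReal.ofReal_le_ofReal_iff (by positivity)).1 (h.trans h')
  have hsub : volume {x | l < ‖u x‖} ≤ volume {x | ENNReal.ofReal (l / 2) ≤ ‖w x‖ₑ} := by
    refine measure_mono_ae ?_
    filter_upwards [hdec] with x hx hlx
    change ENNReal.ofReal (l / 2) ≤ ‖w x‖ₑ
    rw [← ofReal_norm]
    refine ENNReal.ofReal_le_ofReal ?_
    have h1 : l < ‖u x‖ := hlx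
    have h2 := norm_add_le (𝓕⁻ (fun ξ => v ξ * ψ ξ) x) (w x)
    rw [← hx] at h2
    linarith [hlow' x]
  have hcheb := meas_ge_le_mul_pow_eLpNorm_enorm volume (p := 2) two_ne_zero ENNReal.ofNat_ne_top
    hw.1 (ε := ENNReal.ofReal (l / 2)) (by simpa using hl) (by simp)
  rw [hwnorm, eLpNorm_eq_lintegral_rpow_enorm_toReal two_ne_zero ENNReal.ofNat_ne_top,
    ← ENNReal.rpow_mul] at hcheb
  simp only [ENNReal.toReal_ofNat, one_div, inv_mul_cancel₀ (two_ne_zero' ℝ),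
    ENNReal.rpow_one] at hcheb
  refine (hsub.trans hcheb).trans (mul_le_mul' (le_of_eq ?_) (lintegral_mono fun ξ => ?_))
  · rw [← ENNReal.ofReal_inv_of_pos (by positivity), ENNReal.ofReal_rpow_of_pos (by positivity)]
    congr 1
    rw [Real.rpow_neg hl.le, Real.rpow_two, Real.rpow_two]
    field_simp
    norm_num
  -- By the choice of t, the condition says t‖ξ‖ > 1; off this set ψ = 1 and the high part vanishes.
  · by_cases hξ : l < 2 * C * m * ‖ξ‖ ^ γ
    · rw [Set.indicator_of_mem (by exact hξ), enorm_mul]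
      refine ENNReal.rpow_le_rpow ?_ (by norm_num)
      refine mul_le_of_le_one_right' ?_
      rw [← ofReal_norm, ENNReal.ofReal_le_one]
      exact hψle ξ
    · have : t * ‖ξ‖ ≤ 1 := by
        by_contra! h
        refine hξ ?_
        have h1 := Real.one_lt_rpow h hγ
        rw [Real.mul_rpow ht.le (norm_nonneg _), htγ, div_mul_eq_mul_div, one_lt_div hl] at h1
        exact h1
      simp [hψ1 ξ this]

/-! ### The endpoint inequality by layer cake -/

theorem mul_critExp_eq {N : ℕ} {s : ℝ} (hsN : s < (N : ℝ) / 2) :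
    (N - 2 * s) / 2 * critExp N s = N := by
  have : (N : ℝ) - 2 * s ≠ 0 := by linarith
  rw [critExp]
  field_simp

theorem two_lt_critExp {N : ℕ} {s : ℝ} (hs0 : 0 < s) (hsN : s < (N : ℝ) / 2) :
    2 < critExp N s := by
  rw [critExp, lt_div_iff₀ (by linarith)]
  linarith

/-- The `L^{2*}` norm is estimated by the critical power of the Sobolev norm and a power of a
bound for the Morrey norm. -/
theorem exists_eLpNorm_critExp_le_of_morreyNorm_le {N : ℕ} {s : ℝ} (hs0 : 0 < s)
    (hsN : s < (N : ℝ) / 2) :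
    ∃ C : ℝ, 0 < C ∧ ∀ u v : EuclideanSpace ℝ (Fin N) → ℂ, LocallyIntegrable u →
      HasFourierTransform u v → MemLp (fracSymbol s v) 2 →
      ∀ r : ℝ, 1 ≤ r → ∀ m : ℝ, 0 < m →
      morreyNorm r (r * ((N - 2 * s) / 2)) u ≤ ENNReal.ofReal m →
      eLpNorm u (ENNReal.ofReal (critExp N s)) ≤ ENNReal.ofReal C *
        eLpNorm (fracSymbol s v) 2 ^ (2 / critExp N s) *
          ENNReal.ofReal m ^ (1 - 2 / critExp N s) := by
  have hγp := mul_critExp_eq hsN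
  have hp2 := two_lt_critExp hs0 hsN
  set p := critExp N s with hp
  set γ : ℝ := (N - 2 * s) / 2 with hγ_def
  have hγ : 0 < γ := by
    rw [hγ_def]
    linarith
  have hp0 : 0 < p := by linarith
  set q := p - 2 with hq_def
  have hq : 0 < q := by
    rw [hq_def]
    linarith
  -- This makes the weight produced by the layer cake formula the Sobolev weight.
  have hγq : γ * q = 2 * s := by
    rw [hq_def, mul_sub, hγp, hγ_def]
    ring
  obtain ⟨B, hB, hdist⟩ := exists_measure_lt_norm_le (N := N) hs0.le hγ
  refine ⟨(p * 4 * q⁻¹ * B ^ q) ^ (1 / p), by positivity, ?_⟩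
  intro u v hu huv hv r hr m hm hM
  have hvm : AEMeasurable (fun ξ => ‖v ξ‖ₑ ^ (2 : ℝ)) :=
    huv.1.aestronglyMeasurable.enorm.pow_const _
  -- With respect to |v|² dξ, the bound on the distribution function of u is 4 l^(-2) ν{a > l}, so a
  -- second layer cake computes its integral over l.
  set ν : Measure (EuclideanSpace ℝ (Fin N)) := volume.withDensity fun ξ => ‖v ξ‖ₑ ^ (2 : ℝ)
    with hν
  set a : EuclideanSpace ℝ (Fin N) → ℝ := fun ξ => B * m * ‖ξ‖ ^ γ with ha
  have ham : Measurable a := by fun_prop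
  have ha0 : ∀ ξ, 0 ≤ a ξ := fun ξ => by positivity
  have hcakeν := lintegral_rpow_eq_lintegral_meas_lt_mul ν (Filter.Eventually.of_forall ha0)
    ham.aemeasurable hq
  have hcake := lintegral_rpow_eq_lintegral_meas_lt_mul volume
    (Filter.Eventually.of_forall fun x => norm_nonneg (u x)) hu.aestronglyMeasurable.norm.aemeasurable
    hp0
  have haν : ∫⁻ ξ, ENNReal.ofReal (a ξ ^ q) ∂ν ≤
      ENNReal.ofReal ((B * m) ^ q) * eLpNorm (fracSymbol s v) 2 ^ (2 : ℝ) := by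
    rw [hν, lintegral_withDensity_eq_lintegral_mul₀ hvm (by fun_prop),
      eLpNorm_eq_lintegral_rpow_enorm_toReal two_ne_zero ENNReal.ofNat_ne_top,
      ← ENNReal.rpow_mul]
    simp only [ENNReal.toReal_ofNat, one_div, inv_mul_cancel₀ (two_ne_zero' ℝ), ENNReal.rpow_one]
    rw [← lintegral_const_mul' _ _ ENNReal.ofReal_ne_top]
    refine lintegral_mono fun ξ => ?_
    rw [Pi.mul_apply, fracSymbol, enorm_mul, ENNReal.mul_rpow_of_nonneg _ _ zero_le_two,
      mul_comm, ← mul_assoc, ← ofReal_norm (Complex.ofReal _), Complex.norm_real,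
      Real.norm_of_nonneg (by positivity), ENNReal.ofReal_rpow_of_nonneg (by positivity)
      zero_le_two, ← ENNReal.ofReal_mul (by positivity)]
    gcongr
    rw [ha]
    simp only
    rw [Real.mul_rpow (by positivity) (by positivity), ← Real.rpow_mul (norm_nonneg _),
      ← Real.rpow_mul (by positivity), hγq, mul_comm s 2]
    gcongr
    nlinarith [Real.pi_gt_three, norm_nonneg ξ]
  have hmain : ∫⁻ x, ENNReal.ofReal (‖u x‖ ^ p) ≤ ENNReal.ofReal (p * 4 * q⁻¹) *
      ∫⁻ ξ, ENNReal.ofReal (a ξ ^ q) ∂ν := by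
    have hpq : ENNReal.ofReal (p * 4 * q⁻¹) * ENNReal.ofReal q =
        ENNReal.ofReal p * ENNReal.ofReal 4 := by
      rw [← ENNReal.ofReal_mul (by positivity), ← ENNReal.ofReal_mul (by positivity)]
      congr 1
      field_simp
    rw [hcake, hcakeν, ← mul_assoc, hpq, mul_assoc,
      ← lintegral_const_mul' (ENNReal.ofReal 4) _ ENNReal.ofReal_ne_top]
    gcongr ENNReal.ofReal p * ?_
    refine setLIntegral_mono' measurableSet_Ioi fun l hl => ?_
    have hl0 : 0 < l := hl
    have h := hdist u v hu huv hv r hr m hm hM l hl0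
    rw [lintegral_indicator (measurableSet_lt measurable_const ham),
      ← withDensity_apply _ (measurableSet_lt measurable_const ham)] at h
    refine (mul_le_mul_left h _).trans_eq ?_
    have hl2 : ENNReal.ofReal (4 * l ^ (-2 : ℝ)) * ENNReal.ofReal (l ^ (p - 1)) =
        ENNReal.ofReal 4 * ENNReal.ofReal (l ^ (q - 1)) := by
      rw [← ENNReal.ofReal_mul (by positivity), ← ENNReal.ofReal_mul (by positivity), mul_assoc,
        ← Real.rpow_add hl0]
      congr 3
      rw [hq_def]
      ring
    rw [mul_right_comm, hl2, mul_right_comm, mul_assoc]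
  rw [eLpNorm_eq_lintegral_rpow_enorm_toReal (by simpa using hp0) ENNReal.ofReal_ne_top,
    ENNReal.toReal_ofReal hp0.le]
  have hup : ∫⁻ x, ‖u x‖ₑ ^ p = ∫⁻ x, ENNReal.ofReal (‖u x‖ ^ p) := by
    refine lintegral_congr fun x => ?_
    rw [← ofReal_norm, ENNReal.ofReal_rpow_of_nonneg (norm_nonneg _) hp0.le]
  have hfin : ∫⁻ x, ‖u x‖ₑ ^ p ≤ ENNReal.ofReal (p * 4 * q⁻¹ * B ^ q) *
      eLpNorm (fracSymbol s v) 2 ^ (2 : ℝ) * ENNReal.ofReal m ^ q := by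
    rw [hup]
    refine (hmain.trans (mul_le_mul_right haν _)).trans_eq ?_
    rw [Real.mul_rpow hB.le hm.le, ENNReal.ofReal_rpow_of_pos hm,
      ENNReal.ofReal_mul (p := B ^ q) (by positivity), ENNReal.ofReal_mul (q := B ^ q) (by positivity)]
    ring
  refine (ENNReal.rpow_le_rpow hfin (by positivity)).trans_eq ?_
  rw [ENNReal.mul_rpow_of_nonneg _ _ (by positivity), ENNReal.mul_rpow_of_nonneg _ _ (by positivity),
    ENNReal.ofReal_rpow_of_pos (by positivity), ← ENNReal.rpow_mul, ← ENNReal.rpow_mul]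
  congr 2
  · congr 1
    ring
  · rw [hq_def]
    field_simp

/-- Settles the case excluded from the level set argument, which needs a positive bound m for the
Morrey norm. -/
theorem ae_eq_zero_of_morreyNorm_eq_zero {N : ℕ} {u : EuclideanSpace ℝ (Fin N) → ℂ}
    (hu : AEStronglyMeasurable u) {r γ : ℝ} (hr : 1 ≤ r) (h : morreyNorm r (r * γ) u = 0) :
    u =ᵐ[volume] 0 := by
  have hball : ∀ n : ℕ, ∀ᵐ x ∂volume.restrict
      (Metric.ball (0 : EuclideanSpace ℝ (Fin N)) (n + 1)), u x = 0 := by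
    intro n
    have h1 := lintegral_ball_le_morreyNorm hu (γ := γ) hr 0 (R := (n : ℝ) + 1) (by positivity)
    rw [h, mul_zero, nonpos_iff_eq_zero, lintegral_eq_zero_iff' hu.enorm.restrict] at h1
    filter_upwards [h1] with x hx
    simpa using hx
  have hall : ∀ᵐ x, ∀ n : ℕ, x ∈ Metric.ball (0 : EuclideanSpace ℝ (Fin N)) (n + 1) → u x = 0 :=
    ae_all_iff.2 fun n => (ae_restrict_iff' measurableSet_ball).1 (hball n)
  filter_upwards [hall] with x hx
  obtain ⟨n, hn⟩ := exists_nat_gt ‖x‖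
  exact hx n (by rw [mem_ball_zero_iff]; linarith)

/-! ### Norm form of the endpoint, and general θ -/

/-- The refined Sobolev inequality with the smallest admissible power of the Sobolev norm. -/
theorem exists_eLpNorm_critExp_le_homSobolevNorm_mul_morreyNorm {N : ℕ} {s : ℝ} (hs0 : 0 < s)
    (hsN : s < (N : ℝ) / 2) :
    ∃ C : ℝ, 0 < C ∧ ∀ u : EuclideanSpace ℝ (Fin N) → ℂ,
      MemLp u (ENNReal.ofReal (critExp N s)) → ∀ r : ℝ, 1 ≤ r →
      morreyNorm r (r * ((N - 2 * s) / 2)) u ≠ ⊤ →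
      eLpNorm u (ENNReal.ofReal (critExp N s)) ≤ ENNReal.ofReal C *
        homSobolevNorm s u ^ (2 / critExp N s) *
          morreyNorm r (r * ((N - 2 * s) / 2)) u ^ (1 - 2 / critExp N s) := by
  obtain ⟨C, hC, hmain⟩ := exists_eLpNorm_critExp_le_of_morreyNorm_le hs0 hsN
  have hp2 := two_lt_critExp hs0 hsN
  refine ⟨C, hC, fun u hu r hr hMt => ?_⟩
  set M := morreyNorm r (r * ((N - 2 * s) / 2)) u
  set p := critExp N s
  have hp0 : 0 < p := by linarith
  have hθ : 0 < 2 / p := by positivity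
  rcases eq_or_ne M 0 with hM0 | hM0
  · rw [eLpNorm_congr_ae (ae_eq_zero_of_morreyNorm_eq_zero hu.1 hr hM0), eLpNorm_zero]
    exact zero_le
  have hm : 0 < M.toReal := ENNReal.toReal_pos hM0 hMt
  have huloc : LocallyIntegrable u :=
    hu.locallyIntegrable (by rw [ENNReal.one_le_ofReal]; linarith)
  have hD0 : ENNReal.ofReal C * M ^ (1 - 2 / p) ≠ 0 := by
    refine mul_ne_zero (by simpa using hC) ?_
    exact (ENNReal.rpow_pos (pos_iff_ne_zero.2 hM0) hMt).ne'
  have hDt : ENNReal.ofReal C * M ^ (1 - 2 / p) ≠ ⊤ :=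
    ENNReal.mul_ne_top ENNReal.ofReal_ne_top (ENNReal.rpow_ne_top_of_ne_zero hM0 hMt)
  -- The Sobolev norm is an infimum over v, so it is isolated by division and the bound is proved
  -- for each v.
  rw [mul_right_comm]
  rw [mul_comm, ← ENNReal.div_le_iff hD0 hDt, ← ENNReal.rpow_inv_le_iff hθ, homSobolevNorm]
  refine le_iInf fun v => le_iInf fun huv => ?_
  rw [ENNReal.rpow_inv_le_iff hθ, ENNReal.div_le_iff hD0 hDt, mul_comm, mul_right_comm]
  rcases eq_or_ne (eLpNorm (fracSymbol s v) 2) ⊤ with htop | htop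
  · rw [htop, ENNReal.top_rpow_of_pos hθ, mul_right_comm, ENNReal.mul_top hD0]
    exact le_top
  have hmeas : AEStronglyMeasurable (fracSymbol s v) := by
    refine AEStronglyMeasurable.mul ?_ huv.1.aestronglyMeasurable
    have : Measurable fun ξ : EuclideanSpace ℝ (Fin N) => (2 * π * ‖ξ‖) ^ s := by fun_prop
    exact (Complex.measurable_ofReal.comp this).aestronglyMeasurable
  have h := hmain u v huloc huv ⟨hmeas, lt_top_iff_ne_top.2 htop⟩ r hr M.toReal hm
    (ENNReal.ofReal_toReal hMt).ge
  rwa [ENNReal.ofReal_toReal hMt] at h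

theorem theorem1p1 (N : ℕ) (s : ℝ) (hs0 : 0 < s) (hsN : s < (N : ℝ) / 2) :
    ∃ C : ℝ, 0 < C ∧
      ∀ θ : ℝ, 2 / critExp N s ≤ θ → θ < 1 →
      ∀ r : ℝ, 1 ≤ r → r < critExp N s →
      ∀ u : EuclideanSpace ℝ (Fin N) → ℂ, MemHomSobolev s u →
        eLpNorm u (ENNReal.ofReal (critExp N s)) volume ≤
          ENNReal.ofReal C * homSobolevNorm s u ^ θ *
            morreyNorm r (r * (N - 2 * s) / 2) u ^ (1 - θ) := by
  obtain ⟨C, hC, hmain⟩ := exists_eLpNorm_critExp_le_homSobolevNorm_mul_morreyNorm hs0 hsN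
  have hγp := mul_critExp_eq hsN
  have hp2 := two_lt_critExp hs0 hsN
  set p := critExp N s
  set c : ℝ≥0∞ := (volume (Metric.ball (0 : EuclideanSpace ℝ (Fin N)) 1))⁻¹ ^ (1 / p) with hc
  set θ₀ := 2 / p with hθ₀
  have hp0 : 0 < p := by linarith
  have hθ₀0 : 0 < θ₀ := by positivity
  have hθ₀1 : θ₀ < 1 := by
    rw [hθ₀, div_lt_one hp0]
    exact hp2
  have hct : c ≠ ⊤ := ENNReal.rpow_ne_top_of_nonneg (by positivity)
    (ENNReal.inv_ne_top.2 (Metric.measure_ball_pos volume _ one_pos).ne')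
  -- Solving A ≤ C H^θ₀ (cA)^(1-θ₀) for A and using M ≤ cA gives M ≤ S H.
  set S : ℝ≥0∞ := c * (ENNReal.ofReal C * c ^ (1 - θ₀)) ^ θ₀⁻¹ with hS
  -- With base at least 1, the power θ - θ₀ ≤ 1 of `max 1 S` is at most `max 1 S`, so the constant
  -- is uniform in θ.
  have hSt : max 1 S ≠ ⊤ := by
    refine (max_lt ENNReal.one_lt_top (lt_top_iff_ne_top.2 ?_)).ne
    refine ENNReal.mul_ne_top hct (ENNReal.rpow_ne_top_of_nonneg (by positivity) ?_)
    exact ENNReal.mul_ne_top ENNReal.ofReal_ne_top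
      (ENNReal.rpow_ne_top_of_nonneg (by linarith) hct)
  have hS0 : 0 < (max 1 S).toReal :=
    ENNReal.toReal_pos (zero_lt_one.trans_le (le_max_left _ _)).ne' hSt
  refine ⟨C * (max 1 S).toReal, by positivity, ?_⟩
  intro θ hθ hθ1 r hr hrp u hu
  rw [mul_div_assoc, ENNReal.ofReal_mul hC.le, ENNReal.ofReal_toReal hSt]
  have hMA := morreyNorm_le_eLpNorm hu.1.1 hr hrp.le hγp
  have hAt : eLpNorm u (ENNReal.ofReal p) ≠ ⊤ := hu.1.2.ne
  have hMt : morreyNorm r (r * ((N - 2 * s) / 2)) u ≠ ⊤ :=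
    ne_top_of_le_ne_top (ENNReal.mul_ne_top hct hAt) hMA
  have hA := hmain u hu.1 r hr hMt
  set M := morreyNorm r (r * ((N - 2 * s) / 2)) u
  set A := eLpNorm u (ENNReal.ofReal p)
  set H := homSobolevNorm s u
  rcases eq_or_ne A 0 with hA0 | hA0
  · rw [hA0]
    exact zero_le
  -- Cancelling A^(1-θ₀) requires 0 < A < ∞; finiteness is the hypothesis that u lies in L^p.
  have hMH : M ≤ S * H := by
    have h1 : A ^ θ₀ ≤ ENNReal.ofReal C * c ^ (1 - θ₀) * H ^ θ₀ := by
      have hpow0 : A ^ (1 - θ₀) ≠ 0 := (ENNReal.rpow_pos (pos_iff_ne_zero.2 hA0) hAt).ne'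
      have hpowt : A ^ (1 - θ₀) ≠ ⊤ := ENNReal.rpow_ne_top_of_ne_zero hA0 hAt
      rw [← ENNReal.mul_le_mul_iff_left hpow0 hpowt, ← ENNReal.rpow_add _ _ hA0 hAt,
        add_sub_cancel, ENNReal.rpow_one]
      calc A ≤ ENNReal.ofReal C * H ^ θ₀ * M ^ (1 - θ₀) := hA
        _ ≤ ENNReal.ofReal C * H ^ θ₀ * (c * A) ^ (1 - θ₀) := by
          gcongr
        _ = _ := by
          rw [ENNReal.mul_rpow_of_nonneg _ _ (by linarith)]
          ring
    have h2 : A ≤ (ENNReal.ofReal C * c ^ (1 - θ₀)) ^ θ₀⁻¹ * H := by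
      have h3 := ENNReal.rpow_le_rpow h1 (inv_nonneg.2 hθ₀0.le)
      rwa [ENNReal.mul_rpow_of_nonneg _ _ (inv_nonneg.2 hθ₀0.le), ENNReal.rpow_rpow_inv hθ₀0.ne',
        ENNReal.rpow_rpow_inv hθ₀0.ne'] at h3
    rw [hS, mul_assoc]
    exact hMA.trans (mul_le_mul_right h2 _)
  calc A ≤ ENNReal.ofReal C * H ^ θ₀ * M ^ (1 - θ₀) := hA
    _ = ENNReal.ofReal C * H ^ θ₀ * (M ^ (θ - θ₀) * M ^ (1 - θ)) := by
      rw [← ENNReal.rpow_add_of_nonneg _ _ (by linarith) (by linarith)]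
      congr 2
      ring
    _ ≤ ENNReal.ofReal C * H ^ θ₀ * (max 1 S * H ^ (θ - θ₀) * M ^ (1 - θ)) := by
      gcongr
      calc M ^ (θ - θ₀) ≤ (max 1 S * H) ^ (θ - θ₀) := by
            refine ENNReal.rpow_le_rpow (hMH.trans ?_) (by linarith)
            gcongr
            exact le_max_right _ _
        _ = (max 1 S) ^ (θ - θ₀) * H ^ (θ - θ₀) :=
            ENNReal.mul_rpow_of_nonneg _ _ (by linarith)
        _ ≤ max 1 S * H ^ (θ - θ₀) := by
            gcongr
            exact (ENNReal.rpow_le_rpow_of_exponent_le (le_max_left _ _) (by linarith)).trans_eq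
              (ENNReal.rpow_one _)
    _ = _ := by
      have hadd : H ^ θ = H ^ θ₀ * H ^ (θ - θ₀) := by
        rw [← ENNReal.rpow_add_of_nonneg _ _ hθ₀0.le (by linarith)]
        congr 1
        ring
      rw [hadd]
      ring
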